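/- Let $k$ be a field of characteristic $0$ and let $S=k[x_1,x_2,\ldots,y_1,y_2,\ldots]$, where $x_i$ and $y_i$ have weight $i$. Order the monomials of $S$ by the weighted reverse lexicographic order with $x_1>x_2>\cdots>y_1>y_2>\cdots$: monomials are compared first by weight, and, of two distinct monomials of equal weight, the smaller one is that in which the last variable (in the list $x_1,x_2,\ldots,y_1,y_2,\ldots$) having different exponents in the two has the larger exponent. Let $D$ be the $k$-derivation of $S$ with $D(x_i)=x_{i+1}$ and $D(y_i)=y_{i+1}$, let $f_2=x_1y_1$ and $f_n=D(f_{n-1})$ for $n\ge 3$, and let $I=[x_1y_1]=(f_2,f_3,\ldots)$ be the differential ideal generated by $x_1y_1$. Put $\hat x_m=x_m/(m-1)!$ for $m\ge 1$, $\hat x_m=0$ for $m\le 0$, and $\hat f_n=f_n/(n-2)!$ for $n\ge 2$. For $r\ge 2$ and $1\le i_1\le i_2\le\cdots\le i_r$ let $G_{i_1,i_2+1,\ldots,i_r+r-1}$ be the determinant of the $r\times r$ matrix whose $j$-th row ($1\le j\le r$) is $$\bigl(\hat x_{i_j+j-r+1},\ \hat x_{i_j+j-r+2},\ \ldots,\ \hat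 x_{i_j+j-1},\ \hat f_{i_j+j}\bigr).$$ Let $\mathbb G$ be the set consisting of all $f_n$ ($n\ge 2$) and all these determinants, and for an ideal $A$ of $S$ let $\mathrm{In}(A)$ be the ideal generated by the leading terms of the elements of $A$. **Theorem.** $\mathbb G$ is a Groebner basis of $I$; that is, $\mathbb G\subseteq I$ and the leading terms of the elements of $\mathbb G$ generate $\mathrm{In}(I)$. Moreover $$\mathrm{In}(I)=\bigl(x_{i_1}x_{i_2}\cdots x_{i_r}\,y_r \;:\; r\ge 1,\ i_1,\ldots,i_r\ge 1\bigr).$$ -/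

import Mathlib

open MvPolynomial

namespace NodeArc

/-- The variables `x₁, x₂, …, y₁, y₂, …`, linearly ordered by their order of appearance: every `x`
comes before every `y`, and the indices increase inside each family. -/
abbrev Var : Type := ℕ+ ⊕ₗ ℕ+

/-- The weight of a variable: `x_i` and `y_i` both have weight `i`. -/
def wt (v : Var) : ℕ := Sum.elim (fun i : ℕ+ => (i : ℕ)) (fun i : ℕ+ => (i : ℕ)) (ofLex v)

theorem wt_pos (v : Var) : 0 < wt v := by
  unfold wt
  rcases ofLex v with i | i <;> simp

theorem finite_wt_le (n : ℕ) : {v : Var | wt v ≤ n}.Finite := by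
  have h : {i : ℕ+ | (i : ℕ) ≤ n}.Finite :=
    Set.Finite.preimage (f := fun i : ℕ+ => (i : ℕ)) PNat.coe_injective.injOn (Set.finite_Iic n)
  refine ((h.image (Sum.inlₗ (β := ℕ+))).union (h.image (Sum.inrₗ (α := ℕ+)))).subset ?_
  intro v hv
  rcases hw : ofLex v with i | i
  · left
    refine ⟨i, ?_, ?_⟩
    · simpa [wt, hw] using hv
    · exact hw.symm
  · right
    refine ⟨i, ?_, ?_⟩
    · simpa [wt, hw] using hv
    · exact hw.symm

/-- The weight of the monomial with exponent `a`, i.e. the sum over `v` of `a v * wt v`. -/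
noncomputable def weight : (Var →₀ ℕ) →+ ℕ := Finsupp.weight wt

theorem finite_weight_eq (n : ℕ) : {a : Var →₀ ℕ | weight a = n}.Finite := by
  refine (Set.finite_Iic
    (Finsupp.indicator (finite_wt_le n).toFinset (fun _ _ => n) : Var →₀ ℕ)).subset ?_
  intro a ha v
  by_cases hv : a v = 0
  · simp [hv]
  have h1 : wt v ≤ n := by
    rw [← (show weight a = n from ha)]
    exact Finsupp.le_weight_of_ne_zero' wt hv
  have h2 : a v ≤ n := by
    rw [← (show weight a = n from ha)]
    exact Finsupp.le_weight wt (wt_pos v).ne' a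
  rw [Finsupp.indicator_of_mem (by simpa using h1)]
  exact h2

/-- Exponents of monomials, to be compared by the weighted reverse lexicographic order. -/
def WRevLex : Type := Var →₀ ℕ

noncomputable instance : AddCommMonoid WRevLex := inferInstanceAs (AddCommMonoid (Var →₀ ℕ))

/-- The key by which exponents are compared: first the weight; for equal weights, `a` is smaller
than `b` iff at the last variable at which they differ the exponent of `a` is the larger one
(this is the dual of the colexicographic order). -/
noncomputable def revLexKey (a : Var →₀ ℕ) : ℕ ×ₗ (Colex (Var →₀ ℕ))ᵒᵈ :=
  toLex (weight a, OrderDual.toDual (toColex a))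

theorem revLexKey_injective : Function.Injective revLexKey := by
  intro a b h
  simpa [revLexKey] using (congrArg (fun p => (ofLex p).2) h)

noncomputable instance : LinearOrder WRevLex :=
  LinearOrder.lift' (fun a : WRevLex => revLexKey a) revLexKey_injective

theorem revLexKey_le (a b : Var →₀ ℕ) : revLexKey a ≤ revLexKey b ↔
    weight a < weight b ∨ weight a = weight b ∧ toColex b ≤ toColex a := by
  simp [revLexKey, Prod.Lex.toLex_le_toLex]

theorem revLexKey_add_le {a b : Var →₀ ℕ} (h : revLexKey a ≤ revLexKey b) (c : Var →₀ ℕ) :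
    revLexKey (a + c) ≤ revLexKey (b + c) := by
  rw [revLexKey_le, map_add, map_add, toColex_add, toColex_add]
  rcases (revLexKey_le _ _).1 h with h | ⟨h1, h2⟩
  · exact Or.inl (by omega)
  · exact Or.inr ⟨by rw [h1], by gcongr⟩

theorem WRevLex.le_def (a b : WRevLex) : a ≤ b ↔ revLexKey a ≤ revLexKey b := Iff.rfl

theorem WRevLex.lt_def (a b : WRevLex) : a < b ↔ revLexKey a < revLexKey b := Iff.rfl

instance : IsOrderedAddMonoid WRevLex where
  add_le_add_left _ _ h c := revLexKey_add_le h c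

instance : WellFoundedLT WRevLex := by
  refine ⟨WellFounded.wellFounded_iff_has_min.2 fun s hs => ?_⟩
  obtain ⟨a, has, hmin⟩ :=
    (InvImage.wf (fun a : WRevLex => weight a) Nat.lt_wfRel.wf).has_min s hs
  have hfin : (s ∩ {b : WRevLex | weight b = weight a}).Finite :=
    (finite_weight_eq (weight a)).subset fun b hb => hb.2
  obtain ⟨b, hb, hbmin⟩ := hfin.exists_minimal ⟨a, has, rfl⟩
  refine ⟨b, hb.1, fun c hc hlt => ?_⟩
  have hle : weight c ≤ weight b := by
    rcases (revLexKey_le _ _).1 ((WRevLex.le_def _ _).1 hlt.le) with h | h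
    · exact h.le
    · exact h.1.le
  have hca : weight c = weight a :=
    le_antisymm (hle.trans_eq hb.2) (not_lt.1 (hmin c hc))
  exact absurd (hbmin ⟨hc, hca⟩ hlt.le) (not_le_of_gt hlt)

/-- The weighted reverse lexicographic order on `k[x₁, x₂, …, y₁, y₂, …]`. -/
noncomputable def wrevlex : MonomialOrder Var where
  syn := WRevLex
  toSyn :=
    { toFun := fun a => a
      invFun := fun a => a
      left_inv := fun _ => rfl
      right_inv := fun _ => rfl
      map_add' := fun _ _ => rfl }
  toSyn_monotone := by
    intro a b h
    obtain ⟨c, rfl⟩ := exists_add_of_le h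
    refine (revLexKey_le a (a + c)).2 ?_
    by_cases hc : c = 0
    · right
      simp [hc]
    · left
      obtain ⟨v, hv⟩ := Finsupp.ne_iff.1 hc
      have h1 : wt v ≤ weight c := Finsupp.le_weight_of_ne_zero' wt hv
      have h2 := wt_pos v
      rw [map_add]
      omega

open scoped MonomialOrder in
theorem wrevlex_lt_iff (a b : Var →₀ ℕ) : a ≺[wrevlex] b ↔
    weight a < weight b ∨
      weight a = weight b ∧ ∃ v : Var, (∀ w, v < w → a w = b w) ∧ b v < a v := by
  have h : revLexKey a < revLexKey b ↔
      weight a < weight b ∨ weight a = weight b ∧ toColex b < toColex a := by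
    simp [revLexKey, Prod.Lex.toLex_lt_toLex]
  refine h.trans (or_congr_right (and_congr_right fun _ => ?_))
  rw [Finsupp.Colex.lt_iff]
  exact exists_congr fun v => and_congr_left fun _ => forall₂_congr fun w _ => eq_comm

section Groebner

variable {k : Type*} [Field k] {σ : Type*}

/-- The initial ideal `In(I)`: the ideal generated by the leading terms of the elements of `I`. -/
noncomputable def initialIdeal (m : MonomialOrder σ) (I : Ideal (MvPolynomial σ k)) :
    Ideal (MvPolynomial σ k) :=
  Ideal.span (m.leadingTerm '' (I : Set (MvPolynomial σ k)))

/-- `G` is a Groebner basis of `I`: it is contained in `I`, and the leading terms of its elements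
generate the initial ideal of `I`. -/
def IsGroebnerBasis (m : MonomialOrder σ) (G : Set (MvPolynomial σ k))
    (I : Ideal (MvPolynomial σ k)) : Prop :=
  G ⊆ (I : Set (MvPolynomial σ k)) ∧ Ideal.span (m.leadingTerm '' G) = initialIdeal m I

end Groebner

section Node

variable (k : Type*) [Field k]

/-- The variable `x_i`. -/
noncomputable def x (i : ℕ+) : MvPolynomial Var k := X (Sum.inlₗ i)

/-- The variable `y_i`. -/
noncomputable def y (i : ℕ+) : MvPolynomial Var k := X (Sum.inrₗ i)

/-- The `k`-derivation with `D x_i = x_{i+1}` and `D y_i = y_{i+1}`. -/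
noncomputable def D : Derivation k (MvPolynomial Var k) (MvPolynomial Var k) :=
  mkDerivation k fun v => Sum.elim (fun i : ℕ+ => x k (i + 1)) (fun i : ℕ+ => y k (i + 1)) (ofLex v)

/-- The differential ideal `[h]`, generated by `h` and all its iterated derivatives. -/
noncomputable def diffIdeal (h : MvPolynomial Var k) : Ideal (MvPolynomial Var k) :=
  Ideal.span (Set.range fun n : ℕ => (D k)^[n] h)

/-- `f₂ = x₁ y₁` and `f_n = D (f_{n-1})` for `n ≥ 3`; used for `n ≥ 2` only. -/
noncomputable def f (n : ℕ) : MvPolynomial Var k := (D k)^[n - 2] (x k 1 * y k 1)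

/-- The normalized variable `x_m / (m-1)!` for `m ≥ 1`, and `0` for `m ≤ 0`. -/
noncomputable def xNorm (m : ℤ) : MvPolynomial Var k :=
  if h : 0 < m.toNat then ((m.toNat - 1).factorial : k)⁻¹ • x k ⟨m.toNat, h⟩ else 0

/-- The normalized polynomial `f_n / (n-2)!`; used for `n ≥ 2` only. It is the sum of the products
of normalized variables of indices `a`, `b ≥ 1` with `a + b = n`. -/
noncomputable def fNorm (n : ℕ) : MvPolynomial Var k := ((n - 2).factorial : k)⁻¹ • f k n

/-- Tam's determinant `G_{i₁, i₂+1, …, i_r+r-1}`. With rows and columns numbered from `1`, row `j`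
consists of the normalized variables of indices `i_j + j - r + 1, …, i_j + j - 1`, followed in the
last column by the normalized `f_{i_j + j}`. -/
noncomputable def tamG {r : ℕ} (i : Fin r → ℕ+) : MvPolynomial Var k :=
  Matrix.det (Matrix.of fun j c : Fin r =>
    if (c : ℕ) + 1 < r then xNorm k (((i j : ℕ) : ℤ) - r + 2 + (j : ℕ) + (c : ℕ))
    else fNorm k ((i j : ℕ) + j + 1))

/-- The set consisting of the `f_n`, `n ≥ 2`, and of the determinants with `r ≥ 2` rows and
`1 ≤ i₁ ≤ ⋯ ≤ i_r`. -/
def tamSet : Set (MvPolynomial Var k) :=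
  {p | ∃ n : ℕ, 2 ≤ n ∧ p = f k n} ∪
    {p | ∃ r : ℕ, 2 ≤ r ∧ ∃ i : Fin r → ℕ+, Monotone i ∧ p = tamG k i}

/-- The monomial ideal generated by the `x_{i₁} ⋯ x_{i_r} y_r` with `r ≥ 1` and all `i_j ≥ 1`. -/
noncomputable def monIdeal : Ideal (MvPolynomial Var k) :=
  Ideal.span {p | ∃ (r : ℕ+) (i : Fin r → ℕ+), p = (∏ j, x k (i j)) * y k r}

end Node

end NodeArc

/-!
Up to a factor, the derivatives of `x₁ y₁` are the coefficients `fHat n` of the product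
`(∑ xHat a * t ^ a) * (∑ yHat b * t ^ b)`, where `xHat a = x_{a+1} / a!` and `yHat b = y_{b+1} / b!`.
The indices of the variables are shifted by one throughout, so that they are the powers of `t`.

**The monomials `x_{i₁} ⋯ x_{i_r} y_r` are leading monomials.** In Tam's determinant, the last
column is `∑ b, yHat b` times the column of normalized variables with shift `b`. For `b < r - 1`
that column is already among the others, so only the `yHat b` with `b ≥ r - 1` survive, and `y_r`
comes with the determinant of the normalized variables of index `i_j + j - c`. Its diagonal term
is the largest one, since any other permutation moves weight to a later variable (`isLead_tamG`).
The `f_n` supply the case `r = 1`.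

**There are no other leading monomials.** Let `p` be the number of `x`'s and `q` the number of
`y`'s in a monomial none of whose `y`'s has an index `≤ p`. Dualizing the component of bidegree
`(p, q)`, a polynomial `F (u₁, …, u_p, v₁, …, v_q)` gives a linear functional, whose value at a
product of normalized variables is the sum of the coefficients of `F` at the monomials with the
corresponding exponents, one for each assignment of the `x`'s to the `u`'s and of the `y`'s to the
`v`'s. Multiplication by `u_i - v_j` is dual to an operator which kills the coefficients of
`∑ u_i ^ a * v_j ^ b * t ^ (a + b)`, so the functional vanishes on the differential ideal as soon
as all `u_i - v_j` divide `F` (`pairing_polar_eq_zero`). Take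
`F = (∏ i, j, (u_i - v_j)) * u ^ α * v ^ (β - p)`, where `α` and `β` are the shifted indices in the
given monomial. The term of `F` with all `v`'s chosen from the product corresponds to that monomial,
and every other term, having less weight on the `v`'s, to a larger one. Hence the functional is
nonzero on each polynomial with the given leading monomial, which so cannot lie in the ideal
(`degree_ne_famExp`).
-/

open MvPolynomial

namespace NodeArc

/-! ### Comparing monomials -/

section Order

open scoped MonomialOrder

theorem toColex_lt_single {τ : Type*} [LinearOrder τ] {e : τ →₀ ℕ} {v : τ}
    (h : ∀ w ∈ e.support, w < v) : toColex e < toColex (Finsupp.single v 1) := by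
  rw [Finsupp.Colex.lt_iff]
  have hz : ∀ w, v ≤ w → e w = 0 := fun w hw => by
    by_contra h0
    exact absurd (h w (Finsupp.mem_support_iff.2 h0)) (not_lt.2 hw)
  refine ⟨v, fun w hw => ?_, ?_⟩
  · simp [hz w hw.le, Finsupp.single_eq_of_ne hw.ne']
  · simp [hz v le_rfl]

/-- If every variable of the product `∏ v' s` that differs from its counterpart in `∏ v s` lies
before one of the changed variables `v s₀`, then `∏ v s` is colexicographically larger. -/
theorem toColex_sum_single_lt {τ ι : Type*} [LinearOrder τ] [Fintype ι] (v v' : ι → τ) (s₀ : ι)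
    (hs₀ : v s₀ ≠ v' s₀) (h : ∀ s, v s ≠ v' s → v' s < v s₀) :
    toColex (∑ s, Finsupp.single (v' s) 1 : τ →₀ ℕ) < toColex (∑ s, Finsupp.single (v s) 1) := by
  classical
  rw [← Finset.sum_filter_add_sum_filter_not Finset.univ (fun s => v s = v' s)
      (fun s => (Finsupp.single (v' s) 1 : τ →₀ ℕ)),
    ← Finset.sum_filter_add_sum_filter_not Finset.univ (fun s => v s = v' s)
      (fun s => (Finsupp.single (v s) 1 : τ →₀ ℕ))]
  have h1 : ∑ s with v s = v' s, (Finsupp.single (v' s) 1 : τ →₀ ℕ) =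
      ∑ s with v s = v' s, Finsupp.single (v s) 1 := by
    refine Finset.sum_congr rfl fun s hs => ?_
    rw [(Finset.mem_filter.1 hs).2]
  rw [h1, toColex_add, toColex_add]
  refine add_lt_add_right (lt_of_lt_of_le (toColex_lt_single (v := v s₀) fun w hw => ?_) ?_) _
  · obtain ⟨s, hs, hw⟩ := Finset.mem_biUnion.1 (Finsupp.support_finsetSum hw)
    rw [Finset.mem_singleton.1 (Finsupp.support_single_subset hw)]
    exact h s (Finset.mem_filter.1 hs).2
  · refine Finsupp.toColex_monotone ?_
    exact Finset.single_le_sum (f := fun s => (Finsupp.single (v s) 1 : τ →₀ ℕ))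
      (fun _ _ => zero_le) (Finset.mem_filter.2 ⟨Finset.mem_univ s₀, hs₀⟩)

/-- The variable `x_{a+1}`; the shift of the index makes `a` the power of the parameter which the
variable accompanies in the generating series `∑ x_{a+1} t ^ a / a!`. -/
def xVar (a : ℕ) : Var := Sum.inlₗ a.succPNat

/-- The variable `y_{b+1}`. -/
def yVar (b : ℕ) : Var := Sum.inrₗ b.succPNat

/-- The variable `x_{a+1}` or `y_{a+1}`, according to the side of `ι ⊕ κ` on which `s` lies. -/
def famVar {ι κ : Type*} (s : ι ⊕ κ) (a : ℕ) : Var := Sum.elim (fun _ => xVar a) (fun _ => yVar a) s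

theorem xVar_lt_xVar {a b : ℕ} : xVar a < xVar b ↔ a < b := by
  simp [xVar, Sum.inlₗ]

theorem yVar_lt_yVar {a b : ℕ} : yVar a < yVar b ↔ a < b := by
  simp [yVar, Sum.inrₗ]

theorem xVar_lt_yVar (a b : ℕ) : xVar a < yVar b := Sum.Lex.inl_lt_inr _ _

theorem xVar_injective : Function.Injective xVar := fun a b h => by
  simpa [xVar, Sum.inlₗ] using h

theorem yVar_injective : Function.Injective yVar := fun a b h => by
  simpa [yVar, Sum.inrₗ] using h

theorem famVar_injective {ι κ : Type*} (s : ι ⊕ κ) : Function.Injective (famVar s) := by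
  rcases s with s | s
  exacts [xVar_injective, yVar_injective]

theorem wt_famVar {ι κ : Type*} (s : ι ⊕ κ) (a : ℕ) : wt (famVar s a) = a + 1 := by
  rcases s with s | s <;> simp [famVar, wt, xVar, yVar, Sum.inlₗ, Sum.inrₗ]

variable {ι κ : Type*} [Fintype ι] [Fintype κ]

/-- The exponent of the monomial `∏ i : ι, x_{α i + 1} * ∏ j : κ, y_{α j + 1}`. -/
noncomputable def famExp (α : ι ⊕ κ → ℕ) : Var →₀ ℕ := ∑ s, Finsupp.single (famVar s (α s)) 1

theorem weight_famExp (α : ι ⊕ κ → ℕ) : weight (famExp α) = ∑ s, (α s + 1) := by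
  rw [famExp, map_sum]
  refine Finset.sum_congr rfl fun s _ => ?_
  rw [weight, Finsupp.weight_single, one_smul, wt_famVar]

theorem famExp_lt (α α' : ι ⊕ κ → ℕ) (hsum : ∑ s, α s = ∑ s, α' s) (s₀ : ι ⊕ κ)
    (hs₀ : α s₀ ≠ α' s₀) (h : ∀ s, α s ≠ α' s → famVar s (α' s) < famVar s₀ (α s₀)) :
    famExp α ≺[wrevlex] famExp α' := by
  rw [wrevlex_lt_iff]
  refine Or.inr ⟨by simp [weight_famExp, Finset.sum_add_distrib, hsum], ?_⟩
  obtain ⟨v, hv, hlt⟩ := Finsupp.Colex.lt_iff.1 (toColex_sum_single_lt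
    (fun s => famVar s (α s)) (fun s => famVar s (α' s)) s₀ ((famVar_injective s₀).ne hs₀)
    fun s hs => h s fun h' => hs (by simp only [h']))
  exact ⟨v, fun w hw => (hv w hw).symm, hlt⟩

/-- Moving a part of the weight from the `y`'s to the `x`'s makes a monomial larger. -/
theorem famExp_lt_of_le (α α' : ι ⊕ κ → ℕ) (hsum : ∑ s, α s = ∑ s, α' s)
    (hκ : ∀ j, α' (.inr j) ≤ α (.inr j)) (hne : ∃ j, α' (.inr j) ≠ α (.inr j)) :
    famExp α ≺[wrevlex] famExp α' := by
  classical
  obtain ⟨j₀, hj₀, hmax⟩ := Finset.exists_max_image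
    {j : κ | α' (.inr j) ≠ α (.inr j)} (fun j => α (.inr j)) (by simpa [Finset.Nonempty] using hne)
  rw [Finset.mem_filter] at hj₀
  refine famExp_lt α α' hsum (.inr j₀) hj₀.2.symm fun s hs => ?_
  rcases s with i | j
  · exact xVar_lt_yVar _ _
  · exact yVar_lt_yVar.2 (((hκ j).lt_of_ne hs.symm).trans_le (hmax j (by simpa using hs.symm)))

/-- Among the products of one `y` and of `x`'s whose indices arise from the weakly increasing
`a 0, …, a (r - 1)` by adding `j - τ j` for a permutation `τ`, the largest is the one for `τ = 1`. -/
theorem famExp_perm_lt {r : ℕ} {a : Fin r → ℕ} (ha : Monotone a) (τ : Equiv.Perm (Fin r))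
    (hτ : τ ≠ 1) (hle : ∀ j, (τ j : ℕ) ≤ a j + j) (b : ℕ) :
    famExp (Sum.elim (fun j => a j + j - τ j) fun _ : Unit => b) ≺[wrevlex]
      famExp (Sum.elim a fun _ : Unit => b) := by
  have hsum : ∑ j, (a j + j - τ j) = ∑ j, a j := by
    have h1 : ∑ j, (a j + j - τ j) + ∑ j, (τ j : ℕ) = ∑ j, a j + ∑ j : Fin r, (j : ℕ) := by
      rw [← Finset.sum_add_distrib, ← Finset.sum_add_distrib]
      exact Finset.sum_congr rfl fun j _ => Nat.sub_add_cancel (hle j)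
    rw [Equiv.sum_comp τ (fun j : Fin r => (j : ℕ))] at h1
    omega
  obtain ⟨j, hj⟩ : ∃ j, τ j ≠ j := by
    by_contra! h
    exact hτ (Equiv.ext h)
  obtain ⟨j₀, hj₀, hmax⟩ := Finset.exists_max_image
    {j : Fin r | τ j ≠ j} id ⟨j, by simpa using hj⟩
  simp only [Finset.mem_filter, Finset.mem_univ, true_and, id] at hj₀ hmax
  -- the last index moved by `τ` is moved to the left
  have hlt : τ j₀ < j₀ := by
    refine lt_of_le_of_ne (not_lt.1 fun h => ?_) hj₀
    exact absurd (hmax (τ j₀) fun h' => hj₀ (τ.injective h')) (not_le.2 h)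
  have hlt' : (τ j₀ : ℕ) < j₀ := hlt
  refine famExp_lt _ _ (by simp [hsum]) (.inl j₀) ?_ ?_
  · simp only [Sum.elim_inl]
    omega
  · rintro (j | _) hs
    · refine xVar_lt_xVar.2 ?_
      simp only [Sum.elim_inl] at hs ⊢
      have hj : τ j ≠ j := fun h => hs (by rw [h]; omega)
      have := ha (hmax j hj)
      omega
    · exact absurd rfl hs

end Order

/-! ### The derivatives of `x₁ y₁` -/

section Deriv

variable (k : Type*) [Field k]

/-- The normalized variable `x_{a+1} / a!`. -/
noncomputable def xHat (a : ℕ) : MvPolynomial Var k := (a.factorial : k)⁻¹ • X (xVar a)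

/-- The normalized variable `y_{b+1} / b!`. -/
noncomputable def yHat (b : ℕ) : MvPolynomial Var k := (b.factorial : k)⁻¹ • X (yVar b)

/-- The coefficient of `t ^ n` in the product of the series `∑ xHat a * t ^ a` and
`∑ yHat b * t ^ b`. -/
noncomputable def fHat (n : ℕ) : MvPolynomial Var k :=
  ∑ p ∈ Finset.HasAntidiagonal.antidiagonal n, xHat k p.1 * yHat k p.2

variable [CharZero k]

theorem D_xHat (a : ℕ) : D k (xHat k a) = (a + 1 : k) • xHat k (a + 1) := by
  have h : D k (X (xVar a)) = X (xVar (a + 1)) := by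
    rw [D, mkDerivation_X]
    rfl
  have h0 : (a + 1 : k) ≠ 0 := by exact_mod_cast a.succ_ne_zero
  rw [xHat, Derivation.map_smul, h, xHat, smul_smul, Nat.factorial_succ]
  congr 1
  push_cast
  field_simp

theorem D_yHat (b : ℕ) : D k (yHat k b) = (b + 1 : k) • yHat k (b + 1) := by
  have h : D k (X (yVar b)) = X (yVar (b + 1)) := by
    rw [D, mkDerivation_X]
    rfl
  have h0 : (b + 1 : k) ≠ 0 := by exact_mod_cast b.succ_ne_zero
  rw [yHat, Derivation.map_smul, h, yHat, smul_smul, Nat.factorial_succ]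
  congr 1
  push_cast
  field_simp

theorem D_fHat (n : ℕ) : D k (fHat k n) = (n + 1 : k) • fHat k (n + 1) := by
  have h1 : (n + 1 : k) • fHat k (n + 1) =
      ∑ p ∈ Finset.HasAntidiagonal.antidiagonal (n + 1), (p.1 : k) • (xHat k p.1 * yHat k p.2) +
      ∑ p ∈ Finset.HasAntidiagonal.antidiagonal (n + 1), (p.2 : k) • (xHat k p.1 * yHat k p.2) := by
    rw [fHat, Finset.smul_sum, ← Finset.sum_add_distrib]
    refine Finset.sum_congr rfl fun p hp => ?_
    rw [← add_smul]
    congr 1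
    exact_mod_cast (Finset.HasAntidiagonal.mem_antidiagonal.1 hp).symm
  rw [h1, Finset.Nat.sum_antidiagonal_succ, Finset.Nat.sum_antidiagonal_succ', fHat, map_sum]
  simp only [Nat.cast_zero, zero_smul, zero_add]
  rw [← Finset.sum_add_distrib]
  refine Finset.sum_congr rfl fun p _ => ?_
  rw [Derivation.leibniz, D_xHat, D_yHat]
  simp only [smul_eq_mul, MvPolynomial.smul_eq_C_mul, Nat.cast_add, Nat.cast_one]
  ring

theorem iterate_D_eq (n : ℕ) : (D k)^[n] (x k 1 * y k 1) = (n.factorial : k) • fHat k n := by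
  induction n with
  | zero =>
    simp [fHat, xHat, yHat]
    rfl
  | succ n ih =>
    rw [Function.iterate_succ_apply', ih, Derivation.map_smul, D_fHat, smul_smul, Nat.factorial_succ]
    push_cast
    rw [mul_comm]

theorem fNorm_eq (n : ℕ) : fNorm k (n + 2) = fHat k n := by
  have h : (n.factorial : k) ≠ 0 := by exact_mod_cast n.factorial_ne_zero
  rw [fNorm, f, Nat.add_sub_cancel, iterate_D_eq, smul_smul, inv_mul_cancel₀ h, one_smul]

theorem fHat_mem (n : ℕ) : fHat k n ∈ diffIdeal k (x k 1 * y k 1) := by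
  rw [← fNorm_eq]
  exact Submodule.smul_of_tower_mem _ _ (Ideal.subset_span ⟨n, rfl⟩)

end Deriv

/-! ### Linear functionals vanishing on the differential ideal -/

section Functional

variable {ι κ : Type*} [Fintype ι] [Fintype κ]

/-- The exponent of the monomial `∏ s, W_{s, α s}` in the variables `W_{s, m}` with `s ∈ S` and
`m ∈ ℕ`. -/
noncomputable def multiExp {S : Type*} [Fintype S] (α : S → ℕ) : S × ℕ →₀ ℕ :=
  ∑ s, Finsupp.single (s, α s) 1

theorem multiExp_apply {S : Type*} [Fintype S] [DecidableEq S] (α : S → ℕ) (s : S) (m : ℕ) :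
    multiExp α (s, m) = if α s = m then 1 else 0 := by
  rw [multiExp, Finsupp.finsetSum_apply, Finset.sum_eq_single s]
  · simp [Finsupp.single_apply]
  · intro t _ hts
    simp [hts]
  · simp

/-- Multiplication by `∑ W_{s, a} W_{t, b}`, the sum being over `a + b = n`: the coefficients at
the multilinear monomials do not see whether the exponent of `s` or that of `t` is raised. -/
theorem coeff_multiExp_update {R S : Type*} [CommSemiring R] [Fintype S] [DecidableEq S]
    {s t : S} (hst : s ≠ t) (α : S → ℕ) (n : ℕ) (g : MvPolynomial (S × ℕ) R) :
    coeff (multiExp (α + Pi.single s 1 : S → ℕ))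
        (g * ∑ p ∈ Finset.HasAntidiagonal.antidiagonal n, X (s, p.1) * X (t, p.2)) =
      coeff (multiExp (α + Pi.single t 1 : S → ℕ))
        (g * ∑ p ∈ Finset.HasAntidiagonal.antidiagonal n, X (s, p.1) * X (t, p.2)) := by
  -- the coefficient depends only on the exponents off `s` and `t` and on the sum of those two
  have key : ∀ β : S → ℕ, coeff (multiExp β)
      (g * ∑ p ∈ Finset.HasAntidiagonal.antidiagonal n, X (s, p.1) * X (t, p.2)) =
      if β s + β t = n then
        coeff (∑ r ∈ (Finset.univ.erase t).erase s, Finsupp.single (r, β r) 1) g else 0 := by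
    intro β
    have hβ : multiExp β = (∑ r ∈ (Finset.univ.erase t).erase s, Finsupp.single (r, β r) 1) +
        Finsupp.single (s, β s) 1 + Finsupp.single (t, β t) 1 := by
      rw [multiExp, ← Finset.sum_erase_add _ _ (Finset.mem_univ t),
        ← Finset.sum_erase_add _ _ (Finset.mem_erase.2 ⟨hst, Finset.mem_univ s⟩)]
    have hterm : ∀ p : ℕ × ℕ, coeff (multiExp β) (g * (X (s, p.1) * X (t, p.2))) =
        if (β s, β t) = p then
          coeff (∑ r ∈ (Finset.univ.erase t).erase s, Finsupp.single (r, β r) 1) g else 0 := by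
      rintro ⟨a, b⟩
      rw [← mul_assoc]
      by_cases hb : β t = b
      · subst hb
        rw [hβ, coeff_mul_X]
        by_cases ha : β s = a
        · subst ha
          rw [coeff_mul_X, if_pos rfl]
        · rw [coeff_mul_X', if_neg, if_neg (by simp [ha])]
          simp [Finsupp.single_apply, ha]
      · rw [coeff_mul_X', if_neg, if_neg (by simp [hb])]
        simp [multiExp_apply, hb]
    rw [Finset.mul_sum, coeff_sum, Finset.sum_congr rfl fun p _ => hterm p, Finset.sum_ite_eq]
    simp
  rw [key, key]
  have h1 : (α + Pi.single s 1 : S → ℕ) s + (α + Pi.single s 1 : S → ℕ) t =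
      (α + Pi.single t 1 : S → ℕ) s + (α + Pi.single t 1 : S → ℕ) t := by
    simp [hst, hst.symm]
    omega
  have h2 : ∀ r ∈ (Finset.univ.erase t).erase s,
      (Finsupp.single (r, (α + Pi.single s 1 : S → ℕ) r) 1 : S × ℕ →₀ ℕ) =
        Finsupp.single (r, (α + Pi.single t 1 : S → ℕ) r) 1 := by
    intro r hr
    simp only [Finset.mem_erase] at hr
    simp [hr.1, hr.2.1]
  rw [h1, Finset.sum_congr rfl h2]

variable (k : Type*) [Field k]

/-- The pairing between a polynomial `F` in variables indexed by `S` and the polynomials in the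
variables `W_{s, m}`: the monomial `∏ u_s ^ α s` picks out the coefficient of `∏ W_{s, α s}`. -/
noncomputable def pairing (S : Type*) [Fintype S] :
    MvPolynomial (S × ℕ) k →ₗ[k] MvPolynomial S k →ₗ[k] k :=
  ((basisMonomials S k).constr k : (_ ≃ₗ[k] _)).toLinearMap ∘ₗ
    LinearMap.pi fun α : S →₀ ℕ => lcoeff k (multiExp α)

theorem pairing_monomial {S : Type*} [Fintype S] (g : MvPolynomial (S × ℕ) k) (α : S →₀ ℕ)
    (c : k) : pairing k S g (monomial α c) = c * coeff (multiExp α) g := by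
  have h : (monomial α c : MvPolynomial S k) = c • basisMonomials S k α := by
    simp [smul_monomial]
  rw [h, map_smul, smul_eq_mul]
  exact congrArg (c * ·) ((basisMonomials S k).constr_basis k
    (fun α : S →₀ ℕ => coeff (multiExp α) g) α)

theorem pairing_eq_zero {S : Type*} [Fintype S] {s t : S} (hst : s ≠ t) (n : ℕ)
    (g : MvPolynomial (S × ℕ) k) (F : MvPolynomial S k) :
    pairing k S (g * ∑ p ∈ Finset.HasAntidiagonal.antidiagonal n, X (s, p.1) * X (t, p.2))
      (F * (X s - X t)) = 0 := by
  classical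
  induction F using MvPolynomial.induction_on' with
  | add p q hp hq => rw [add_mul, map_add, hp, hq, add_zero]
  | monomial α c =>
    rw [mul_sub, map_sub, X, X, monomial_mul, monomial_mul, pairing_monomial, pairing_monomial,
      Finsupp.coe_add, Finsupp.coe_add, Finsupp.single_eq_pi_single, Finsupp.single_eq_pi_single,
      coeff_multiExp_update hst, sub_self]

/-- Polarization: the homomorphism sending `x_{m+1}` to `m! * ∑ i : ι, W_{i, m}` and `y_{m+1}` to
`m! * ∑ j : κ, W_{j, m}`. -/
noncomputable def polar (ι κ : Type*) [Fintype ι] [Fintype κ] :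
    MvPolynomial Var k →ₐ[k] MvPolynomial ((ι ⊕ κ) × ℕ) k :=
  aeval fun v => ((wt v - 1).factorial : k) •
    Sum.elim (fun _ => ∑ i : ι, X (Sum.inl i, wt v - 1)) (fun _ => ∑ j : κ, X (Sum.inr j, wt v - 1))
      (ofLex v)

theorem polar_xVar (m : ℕ) : polar k ι κ (X (xVar m)) =
    (m.factorial : k) • ∑ i : ι, X (Sum.inl i, m) := by
  simp [polar, xVar, wt, Sum.inlₗ]

theorem polar_yVar (m : ℕ) : polar k ι κ (X (yVar m)) =
    (m.factorial : k) • ∑ j : κ, X (Sum.inr j, m) := by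
  simp [polar, yVar, wt, Sum.inrₗ]

variable [CharZero k]

theorem polar_fHat (n : ℕ) : polar k ι κ (fHat k n) = ∑ i : ι, ∑ j : κ,
    ∑ p ∈ Finset.HasAntidiagonal.antidiagonal n, X (Sum.inl i, p.1) * X (Sum.inr j, p.2) := by
  have h (m : ℕ) : (m.factorial : k) ≠ 0 := by exact_mod_cast m.factorial_ne_zero
  have hx (m : ℕ) : polar k ι κ (xHat k m) = ∑ i : ι, X (Sum.inl i, m) := by
    rw [xHat, map_smul, polar_xVar, smul_smul, inv_mul_cancel₀ (h m), one_smul]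
  have hy (m : ℕ) : polar k ι κ (yHat k m) = ∑ j : κ, X (Sum.inr j, m) := by
    rw [yHat, map_smul, polar_yVar, smul_smul, inv_mul_cancel₀ (h m), one_smul]
  rw [fHat, map_sum]
  simp_rw [map_mul, hx, hy, Finset.sum_mul_sum]
  rw [Finset.sum_comm]
  exact Finset.sum_congr rfl fun i _ => Finset.sum_comm

/-- Elements of the differential ideal pair to zero with the multiples of `∏ i, j, (u_i - v_j)`. -/
theorem pairing_polar_eq_zero {h : MvPolynomial Var k} (hh : h ∈ diffIdeal k (x k 1 * y k 1))
    (F : MvPolynomial (ι ⊕ κ) k) (hF : ∀ i j, X (Sum.inl i) - X (Sum.inr j) ∣ F) :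
    pairing k _ (polar k ι κ h) F = 0 := by
  refine Submodule.span_induction (p := fun h _ => ∀ g, pairing k _ (polar k ι κ (g * h)) F = 0)
    ?_ ?_ ?_ ?_ hh 1 |> fun H => by rwa [one_mul] at H
  · rintro _ ⟨n, rfl⟩ g
    simp only [iterate_D_eq]
    rw [mul_smul_comm, map_smul, map_smul, LinearMap.smul_apply, map_mul, polar_fHat,
      Finset.mul_sum, map_sum, LinearMap.sum_apply, Finset.sum_eq_zero, smul_zero]
    intro i _
    rw [Finset.mul_sum, map_sum, LinearMap.sum_apply, Finset.sum_eq_zero]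
    intro j _
    obtain ⟨F', rfl⟩ := hF i j
    rw [mul_comm (X _ - X _) F']
    exact pairing_eq_zero k Sum.inl_ne_inr n _ F'
  · simp
  · intro a b _ _ ha hb g
    rw [mul_add, map_add, map_add, LinearMap.add_apply, ha, hb, add_zero]
  · intro a b _ hb g
    rw [smul_eq_mul, ← mul_assoc]
    exact hb _

end Functional

/-! ### Standard monomials are not leading monomials -/

section Standard

open scoped MonomialOrder

variable {ι κ : Type*} [Fintype ι] [Fintype κ] (k : Type*) [Field k]

theorem exists_eq_xVar_or_yVar (v : Var) : ∃ m, v = xVar m ∨ v = yVar m := by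
  rcases h : ofLex v with i | i
  · exact ⟨i.natPred, Or.inl (by simp only [xVar, PNat.succPNat_natPred]; exact h)⟩
  · exact ⟨i.natPred, Or.inr (by simp only [yVar, PNat.succPNat_natPred]; exact h)⟩

theorem monomial_famExp (α : ι ⊕ κ → ℕ) :
    (monomial (famExp α) 1 : MvPolynomial Var k) = ∏ s, X (famVar s (α s)) :=
  monomial_sum_one ..

theorem eq_famExp_of_coeff_polar_ne_zero (e : Var →₀ ℕ) (α : ι ⊕ κ → ℕ)
    (h : coeff (multiExp α) (polar k ι κ (monomial e 1)) ≠ 0) : e = famExp α := by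
  -- giving `W_{s, m}` the variable `famVar s m` as its weight makes `polar` homogeneous
  let w : (ι ⊕ κ) × ℕ → Var →₀ ℕ := fun p => Finsupp.single (famVar p.1 p.2) 1
  have hX : ∀ v, IsWeightedHomogeneous w (polar k ι κ (X v)) (Finsupp.single v 1) := by
    intro v
    obtain ⟨m, rfl | rfl⟩ := exists_eq_xVar_or_yVar v
    · rw [polar_xVar]
      exact (weightedHomogeneousSubmodule k w _).smul_mem _
        (IsWeightedHomogeneous.sum _ _ _ fun i _ => isWeightedHomogeneous_X k w (Sum.inl i, m))
    · rw [polar_yVar]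
      exact (weightedHomogeneousSubmodule k w _).smul_mem _
        (IsWeightedHomogeneous.sum _ _ _ fun j _ => isWeightedHomogeneous_X k w (Sum.inr j, m))
  have he : IsWeightedHomogeneous w (polar k ι κ (monomial e 1)) e := by
    rw [monomial_eq, C_1, one_mul, Finsupp.prod, map_prod]
    have h2 := IsWeightedHomogeneous.prod e.support (fun v => polar k ι κ (X v ^ e v))
      (fun v => e v • Finsupp.single v 1) (w := w) fun v _ => by
        rw [map_pow]
        exact (hX v).pow _
    convert h2 using 1
    conv_lhs => rw [← Finsupp.sum_single e]
    simp [Finsupp.sum]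
  rw [← he h, multiExp, map_sum, famExp]
  refine Finset.sum_congr rfl fun s _ => ?_
  rw [Finsupp.weight_single, one_smul]

theorem coeff_polar_famExp_ne_zero [CharZero k] (α : ι ⊕ κ → ℕ) :
    coeff (multiExp α) (polar k ι κ (monomial (famExp α) 1)) ≠ 0 := by
  classical
  -- each factor is `W_{s, α s}` plus further terms, and all coefficients are natural numbers
  let P : ι ⊕ κ → MvPolynomial ((ι ⊕ κ) × ℕ) ℕ := fun s =>
    Sum.elim (fun _ => ∑ i, X (Sum.inl i, α s)) (fun _ => ∑ j, X (Sum.inr j, α s)) s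
  have hP : ∀ s, polar k ι κ (X (famVar s (α s))) =
      ((α s).factorial : k) • map (Nat.castRingHom k) (P s) := by
    rintro (i | j)
    · simp [famVar, polar_xVar, P]
    · simp [famVar, polar_yVar, P]
  have hP' : ∀ s, ∃ r, P s = X (s, α s) + r := by
    rintro (i | j)
    · exact ⟨_, (Finset.add_sum_erase _ _ (Finset.mem_univ i)).symm⟩
    · exact ⟨_, (Finset.add_sum_erase _ _ (Finset.mem_univ j)).symm⟩
  choose r hr using hP'
  have hprod : ∀ A : Finset (ι ⊕ κ), ∃ q, ∏ s ∈ A, P s = ∏ s ∈ A, X (s, α s) + q := by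
    intro A
    induction A using Finset.induction_on with
    | empty => exact ⟨0, by simp⟩
    | insert s A hs ih =>
      obtain ⟨q, hq⟩ := ih
      refine ⟨X (s, α s) * q + r s * (∏ s ∈ A, X (s, α s) + q), ?_⟩
      rw [Finset.prod_insert hs, Finset.prod_insert hs, hq, hr]
      ring
  obtain ⟨q, hq⟩ := hprod Finset.univ
  have hmono : (∏ s, X (s, α s) : MvPolynomial ((ι ⊕ κ) × ℕ) ℕ) = monomial (multiExp α) 1 :=
    (monomial_sum_one ..).symm
  rw [monomial_famExp, map_prod, Finset.prod_congr rfl fun s _ => hP s, Finset.prod_smul,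
    coeff_smul, smul_eq_mul, ← map_prod, hq, coeff_map, coeff_add, hmono, coeff_monomial,
    if_pos rfl]
  refine mul_ne_zero (Finset.prod_ne_zero_iff.2 fun s _ => ?_) ?_
  · exact_mod_cast (α s).factorial_ne_zero
  · rw [eq_natCast]
    exact_mod_cast (by omega : 1 + coeff (multiExp α) q ≠ 0)

variable [DecidableEq ι] [DecidableEq κ]

/-- The exponent of the term of `u ^ β * ∏ i, j, (u_i - v_j)` which takes `v_j` from the factors
`(i, j) ∈ t` and `u_i` from the others. -/
noncomputable def prodSubExp (β : ι ⊕ κ →₀ ℕ) (t : Finset (ι × κ)) : ι ⊕ κ →₀ ℕ :=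
  (∑ z ∈ Finset.univ \ t, Finsupp.single (Sum.inl z.1) 1) +
    (∑ z ∈ t, Finsupp.single (Sum.inr z.2) 1) + β

theorem prod_sub_mul_monomial (β : ι ⊕ κ →₀ ℕ) :
    ((∏ z : ι × κ, (X (Sum.inl z.1) - X (Sum.inr z.2))) * monomial β 1 : MvPolynomial (ι ⊕ κ) k) =
      ∑ t : Finset (ι × κ), monomial (prodSubExp β t) ((-1) ^ t.card) := by
  have hu (t : Finset (ι × κ)) : (∏ z ∈ Finset.univ \ t, X (Sum.inl z.1) : MvPolynomial (ι ⊕ κ) k) =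
      monomial (∑ z ∈ Finset.univ \ t, Finsupp.single (Sum.inl z.1) 1) 1 :=
    (monomial_sum_one ..).symm
  have hv (t : Finset (ι × κ)) : (∏ z ∈ t, X (Sum.inr z.2) : MvPolynomial (ι ⊕ κ) k) =
      monomial (∑ z ∈ t, Finsupp.single (Sum.inr z.2) 1) 1 :=
    (monomial_sum_one ..).symm
  have hc (t : Finset (ι × κ)) : ((-1) ^ t.card : MvPolynomial (ι ⊕ κ) k) = C ((-1) ^ t.card) := by
    simp
  rw [Finset.prod_sub, Finset.powerset_univ, Finset.sum_mul]
  refine Finset.sum_congr rfl fun t _ => ?_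
  rw [hu, hv, hc, C_mul_monomial, monomial_mul, monomial_mul, prodSubExp]
  simp

theorem sum_prodSubExp (β : ι ⊕ κ →₀ ℕ) (t : Finset (ι × κ)) :
    ∑ s, prodSubExp β t s = Fintype.card (ι × κ) + ∑ s, β s := by
  have h : ∀ (A : Finset (ι × κ)) (g : ι × κ → ι ⊕ κ),
      ∑ s, (∑ z ∈ A, Finsupp.single (g z) 1 : ι ⊕ κ →₀ ℕ) s = A.card := by
    intro A g
    simp only [Finsupp.finsetSum_apply]
    rw [Finset.sum_comm]
    simp [Finsupp.single_apply]
  simp only [prodSubExp, Finsupp.add_apply, Finset.sum_add_distrib]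
  rw [h, h, Finset.card_sdiff_add_card_eq_card (Finset.subset_univ t), Finset.card_univ]

theorem prodSubExp_inr (β : ι ⊕ κ →₀ ℕ) (t : Finset (ι × κ)) (j : κ) :
    prodSubExp β t (Sum.inr j) + {z ∈ Finset.univ \ t | z.2 = j}.card =
      Fintype.card ι + β (Sum.inr j) := by
  have h : ∀ A : Finset (ι × κ),
      (∑ z ∈ A, Finsupp.single (Sum.inr z.2) 1 : ι ⊕ κ →₀ ℕ) (Sum.inr j) = {z ∈ A | z.2 = j}.card := by
    intro A
    rw [Finsupp.finsetSum_apply, Finset.card_filter]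
    exact Finset.sum_congr rfl fun z _ => by simp [Finsupp.single_apply]
  have h0 : (∑ z ∈ Finset.univ \ t, Finsupp.single (Sum.inl z.1) 1 : ι ⊕ κ →₀ ℕ) (Sum.inr j) = 0 := by
    rw [Finsupp.finsetSum_apply]
    exact Finset.sum_eq_zero fun z _ => by simp
  have hcard : (Finset.univ.filter fun z : ι × κ => z.2 = j).card = Fintype.card ι := by
    rw [← Finset.card_univ, ← Finset.card_map ⟨fun i : ι => (i, j), Prod.mk_left_injective j⟩]
    congr 1
    ext ⟨i, j'⟩
    simp [eq_comm]
  rw [prodSubExp, Finsupp.add_apply, Finsupp.add_apply, h0, ← hcard, ← h, ← h,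
    ← Finset.sum_sdiff (Finset.subset_univ t), Finsupp.add_apply]
  ring

/-- The leading monomial of a nonzero element of the differential ideal is not a product of `p`
variables `x` and of variables `y` all of which have an index larger than `p`. -/
theorem degree_ne_famExp [CharZero k] {h : MvPolynomial Var k}
    (hh : h ∈ diffIdeal k (x k 1 * y k 1)) (h0 : h ≠ 0) (α : ι ⊕ κ → ℕ)
    (hα : ∀ j, Fintype.card ι ≤ α (Sum.inr j)) : wrevlex.degree h ≠ famExp α := by
  intro hdeg
  let β : ι ⊕ κ →₀ ℕ := Finsupp.equivFunOnFinite.symm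
    (Sum.elim (fun i => α (Sum.inl i)) fun j => α (Sum.inr j) - Fintype.card ι)
  have hβl : ∀ i, β (Sum.inl i) = α (Sum.inl i) := fun _ => rfl
  have hβr : ∀ j, Fintype.card ι + β (Sum.inr j) = α (Sum.inr j) := fun j =>
    Nat.add_sub_cancel' (hα j)
  have huniv : ⇑(prodSubExp β Finset.univ) = α := by
    ext (i | j)
    · simp [prodSubExp, hβl]
    · simpa [hβr] using prodSubExp_inr β Finset.univ j
  have hlt : ∀ t, t ≠ Finset.univ → famExp α ≺[wrevlex] famExp (prodSubExp β t) := by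
    intro t ht
    obtain ⟨⟨i, j⟩, hij⟩ : ∃ z, z ∉ t := by
      by_contra! H
      exact ht (Finset.eq_univ_iff_forall.2 H)
    refine famExp_lt_of_le _ _ ?_ (fun j => ?_) ⟨j, ?_⟩
    · rw [sum_prodSubExp, ← sum_prodSubExp β Finset.univ, huniv]
    · have := prodSubExp_inr β t j
      rw [hβr] at this
      omega
    · have h1 := prodSubExp_inr β t j
      have h2 : 0 < {z ∈ Finset.univ \ t | z.2 = j}.card :=
        Finset.card_pos.2 ⟨(i, j), by simp [hij]⟩
      rw [hβr] at h1
      omega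
  let F : MvPolynomial (ι ⊕ κ) k :=
    (∏ z : ι × κ, (X (Sum.inl z.1) - X (Sum.inr z.2))) * monomial β 1
  have hF : pairing k _ (polar k ι κ h) F = 0 := pairing_polar_eq_zero k hh F fun i j =>
    Dvd.dvd.mul_right (Finset.dvd_prod_of_mem
      (fun z : ι × κ => (X (Sum.inl z.1) - X (Sum.inr z.2) : MvPolynomial (ι ⊕ κ) k))
      (Finset.mem_univ (i, j))) _
  have hcoeff : ∀ t e, coeff e h * coeff (multiExp (prodSubExp β t))
      (polar k ι κ (monomial e 1)) ≠ 0 → t = Finset.univ ∧ e = famExp α := by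
    intro t e hne
    have he := eq_famExp_of_coeff_polar_ne_zero k e _ (right_ne_zero_of_mul hne)
    have hle := wrevlex.le_degree (mem_support_iff.2 (left_ne_zero_of_mul hne))
    rw [hdeg, he] at hle
    by_cases ht : t = Finset.univ
    · exact ⟨ht, by rw [he, ht, huniv]⟩
    · exact absurd (hlt t ht) (not_lt.2 hle)
  have hexp : ∀ t, coeff (multiExp (prodSubExp β t)) (polar k ι κ h) =
      ∑ e ∈ h.support, coeff e h * coeff (multiExp (prodSubExp β t))
        (polar k ι κ (monomial e 1)) := by
    intro t
    conv_lhs => rw [h.as_sum, map_sum, coeff_sum]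
    refine Finset.sum_congr rfl fun e _ => ?_
    have : monomial e (coeff e h) = coeff e h • (monomial e 1 : MvPolynomial Var k) := by
      simp [smul_monomial]
    rw [this, map_smul, coeff_smul, smul_eq_mul]
  have hd : coeff (famExp α) h ≠ 0 := by
    rw [← hdeg]
    exact wrevlex.leadingCoeff_ne_zero_iff.2 h0
  have hsum : pairing k _ (polar k ι κ h) F = (-1) ^ (Finset.univ : Finset (ι × κ)).card *
      (coeff (famExp α) h * coeff (multiExp α) (polar k ι κ (monomial (famExp α) 1))) := by
    simp only [F]
    rw [prod_sub_mul_monomial, map_sum, Finset.sum_eq_single Finset.univ]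
    · rw [pairing_monomial, hexp, Finset.sum_eq_single (famExp α), huniv]
      · intro e _ he
        by_contra hne
        exact he (hcoeff _ _ hne).2
      · intro hne
        exact absurd (mem_support_iff.2 hd) hne
    · intro t _ ht
      rw [pairing_monomial, hexp, Finset.sum_eq_zero, mul_zero]
      intro e _
      by_contra hne
      exact ht (hcoeff _ _ hne).1
    · simp
  rw [hsum] at hF
  exact mul_ne_zero (by simp) (mul_ne_zero hd (coeff_polar_famExp_ne_zero k α)) hF

end Standard

/-! ### The leading terms of the determinants -/

section Determinant

open scoped MonomialOrder

/-- `p` has the leading monomial `d`, with a nonzero coefficient. -/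
def IsLead {k σ : Type*} [Field k] (m : MonomialOrder σ) (p : MvPolynomial σ k) (d : σ →₀ ℕ) :
    Prop :=
  ∃ c : k, c ≠ 0 ∧ p - monomial d c ∈ restrictSupport k {e | e ≺[m] d}

theorem IsLead.smul {k σ : Type*} [Field k] {m : MonomialOrder σ} {p : MvPolynomial σ k}
    {d : σ →₀ ℕ} (h : IsLead m p d) {u : k} (hu : u ≠ 0) : IsLead m (u • p) d := by
  obtain ⟨c, hc, hp⟩ := h
  refine ⟨u * c, mul_ne_zero hu hc, ?_⟩
  rw [← smul_eq_mul, ← smul_monomial, ← smul_sub]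
  exact Submodule.smul_mem _ _ hp

theorem IsLead.exists_leadingTerm {k σ : Type*} [Field k] {m : MonomialOrder σ}
    {p : MvPolynomial σ k} {d : σ →₀ ℕ} (h : IsLead m p d) :
    ∃ c : k, c ≠ 0 ∧ m.leadingTerm p = monomial d c := by
  classical
  obtain ⟨c, hc, hp⟩ := h
  rw [mem_restrictSupport_iff] at hp
  have hcoeff : ∀ e, ¬ e ≺[m] d → coeff e p = coeff e (monomial d c) := fun e he => by
    have : coeff e (p - monomial d c) = 0 := by
      by_contra h0
      exact he (hp (mem_support_iff.2 h0))
    rwa [coeff_sub, sub_eq_zero] at this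
  have hd : coeff d p = c := by rw [hcoeff d (lt_irrefl _), coeff_monomial, if_pos rfl]
  have hdeg : m.degree p = d := by
    refine m.toSyn.injective (le_antisymm (m.degree_le_iff.2 fun e he => ?_)
      (m.le_degree (mem_support_iff.2 (hd ▸ hc))))
    by_contra hlt
    refine mem_support_iff.1 he ?_
    rw [hcoeff e fun h' => hlt h'.le, coeff_monomial, if_neg]
    rintro rfl
    exact hlt le_rfl
  refine ⟨c, hc, ?_⟩
  rw [MonomialOrder.leadingTerm, MonomialOrder.leadingCoeff, hdeg, hd]

variable (k : Type*) [Field k]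

theorem exists_prod_xHat_mul_yHat [CharZero k] {ι : Type*} [Fintype ι] (a : ι → ℕ) (b : ℕ) :
    ∃ c : k, c ≠ 0 ∧ (∏ j, xHat k (a j)) * yHat k b =
      monomial (famExp (Sum.elim a fun _ : Unit => b)) c := by
  have h (m : ℕ) : (m.factorial : k)⁻¹ ≠ 0 := inv_ne_zero (by exact_mod_cast m.factorial_ne_zero)
  refine ⟨(∏ j, ((a j).factorial : k)⁻¹) * (b.factorial : k)⁻¹,
    mul_ne_zero (Finset.prod_ne_zero_iff.2 fun j _ => h _) (h b), ?_⟩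
  rw [← mul_one ((∏ j, ((a j).factorial : k)⁻¹) * (b.factorial : k)⁻¹),
    ← smul_eq_mul (_ * _) (1 : k), ← smul_monomial, monomial_famExp]
  simp only [xHat, yHat, Finset.prod_smul, smul_mul_smul_comm, Fintype.prod_sum_type]
  simp [famVar]

/-- The coefficient of `t ^ m` in `t ^ s * ∑ xHat a * t ^ a`. -/
noncomputable def xShift (m s : ℕ) : MvPolynomial Var k := if s ≤ m then xHat k (m - s) else 0

theorem fHat_eq_sum_xShift {n B : ℕ} (h : n < B) :
    fHat k n = ∑ b ∈ Finset.range B, xShift k n b * yHat k b := by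
  rw [fHat, ← Finset.sum_subset (Finset.range_subset_range.2 (Nat.succ_le_of_lt h)),
    Finset.Nat.antidiagonal_eq_map', Finset.sum_map]
  · refine Finset.sum_congr rfl fun b hb => ?_
    rw [xShift, if_pos (by simpa [Nat.lt_succ_iff] using hb)]
    rfl
  · intro b _ hb
    rw [xShift, if_neg (by simpa using hb), zero_mul]

theorem xNorm_eq_xShift (z : ℤ) (m s : ℕ) (h : z = m - s + 1) : xNorm k z = xShift k m s := by
  rw [xNorm, xShift]
  by_cases hs : s ≤ m
  · have hz : z.toNat = m - s + 1 := by omega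
    rw [dif_pos (by omega), if_pos hs, xHat]
    have h1 : z.toNat - 1 = m - s := by omega
    rw [h1]
    congr 2
    exact PNat.eq (by simp [hz])
  · rw [dif_neg (by omega), if_neg hs]

/-- The shifts by which the rows of Tam's determinant with `n + 1` rows enter its columns, once the
series in its last column has been replaced by its term containing `y_{b+1}`. -/
def shift (n b : ℕ) (c : Fin (n + 1)) : ℕ := if (c : ℕ) < n then n - 1 - c else b

theorem shift_castSucc (n b : ℕ) (c : Fin n) : shift n b c.castSucc = n - 1 - c := by
  simp [shift]

theorem shift_last (n b : ℕ) : shift n b (Fin.last n) = b := by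
  simp [shift]

theorem sum_shift (n b : ℕ) : ∑ c, shift n b c + n = ∑ c : Fin (n + 1), (c : ℕ) + b := by
  rw [Fin.sum_univ_castSucc, Fin.sum_univ_castSucc]
  simp only [shift_castSucc, shift_last, Fin.val_castSucc, Fin.val_last]
  have : ∑ c : Fin n, (n - 1 - (c : ℕ)) = ∑ c : Fin n, (c : ℕ) := by
    rw [← Equiv.sum_comp Fin.revPerm (fun c : Fin n => (c : ℕ))]
    refine Finset.sum_congr rfl fun c _ => ?_
    rw [Fin.revPerm_apply, Fin.val_rev]
    omega
  omega

theorem exists_perm_shift (n : ℕ) : ∃ π : Equiv.Perm (Fin (n + 1)), ∀ c, shift n n c = π c := by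
  have hlt : ∀ c, shift n n c < n + 1 := fun c => by
    unfold shift
    split_ifs <;> omega
  have hinj : Function.Injective fun c => (⟨shift n n c, hlt c⟩ : Fin (n + 1)) := by
    intro c c' h
    have h' : shift n n c = shift n n c' := congrArg Fin.val h
    unfold shift at h'
    split_ifs at h' <;> ext <;> omega
  exact ⟨Equiv.ofBijective _ (Finite.injective_iff_bijective.1 hinj), fun c => rfl⟩

theorem tamG_eq_sum [CharZero k] {n B : ℕ} (i : Fin (n + 1) → ℕ+)
    (hB : ∀ j, (i j).natPred + j < B) :
    tamG k i = ∑ b ∈ Finset.range B, yHat k b *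
      Matrix.det (Matrix.of fun j c => xShift k ((i j).natPred + j) (shift n b c)) := by
  have hi : ∀ j, (i j : ℕ) = (i j).natPred + 1 := fun j => (PNat.natPred_add_one _).symm
  have hcol : ∀ (j : Fin (n + 1)) (c : Fin n) (b : ℕ),
      xNorm k (((i j : ℕ) : ℤ) - (n + 1 : ℕ) + 2 + (j : ℕ) + (c.castSucc : Fin (n + 1)).val) =
        xShift k ((i j).natPred + j) (shift n b c.castSucc) := by
    intro j c b
    refine xNorm_eq_xShift k _ _ _ ?_
    have := hi j
    rw [shift_castSucc, Fin.val_castSucc]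
    omega
  have hlast : ∀ j : Fin (n + 1), fNorm k ((i j : ℕ) + j + 1) =
      ∑ b ∈ Finset.range B, xShift k ((i j).natPred + j) b * yHat k b := by
    intro j
    rw [← fHat_eq_sum_xShift k (hB j), ← fNorm_eq, hi j]
    congr 1
    omega
  simp only [tamG, Matrix.det_apply', Finset.mul_sum]
  rw [Finset.sum_comm]
  refine Finset.sum_congr rfl fun σ _ => ?_
  simp only [Fin.prod_univ_castSucc, Matrix.of_apply]
  rw [if_neg (by simp), hlast, Finset.mul_sum, Finset.mul_sum]
  refine Finset.sum_congr rfl fun b _ => ?_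
  rw [shift_last, Finset.prod_congr rfl fun c _ => by rw [if_pos (by simp), hcol _ c b]]
  ring

theorem isLead_tamG [CharZero k] {n : ℕ} (i : Fin (n + 1) → ℕ+) (hi : Monotone i) :
    IsLead wrevlex (tamG k i) (famExp (Sum.elim (fun j => (i j).natPred) fun _ : Unit => n)) := by
  obtain ⟨π, hπ⟩ := exists_perm_shift n
  set a : Fin (n + 1) → ℕ := fun j => (i j).natPred
  have ha : Monotone a := fun j j' h => Nat.sub_le_sub_right (hi h) 1
  set d := famExp (Sum.elim a fun _ : Unit => n)
  obtain ⟨B, hB, hn⟩ : ∃ B, (∀ j, a j + j < B) ∧ n < B := by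
    refine ⟨∑ j, a j + n + 1, fun j => ?_, by omega⟩
    have := Finset.single_le_sum (f := a) (fun _ _ => zero_le) (Finset.mem_univ j)
    omega
  -- the term of the determinant which belongs to `σ`, in the coefficient of `y_{b+1}`
  let T : ℕ → Equiv.Perm (Fin (n + 1)) → MvPolynomial Var k := fun b σ =>
    (∏ j, xShift k (a j + j) (shift n b (σ⁻¹ j))) * yHat k b
  have hinv : ∀ (σ : Equiv.Perm (Fin (n + 1))) j, σ (σ⁻¹ j) = j := fun σ => σ.apply_symm_apply
  have hdet : ∀ b, yHat k b *
      Matrix.det (Matrix.of fun j c => xShift k (a j + j) (shift n b c)) =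
        ∑ σ : Equiv.Perm (Fin (n + 1)), ((Equiv.Perm.sign σ : ℤ) : k) • T b σ := by
    intro b
    rw [Matrix.det_apply', Finset.mul_sum]
    refine Finset.sum_congr rfl fun σ _ => ?_
    rw [← Equiv.prod_comp σ⁻¹]
    simp only [Matrix.of_apply, hinv, T, smul_eq_C_mul, map_intCast]
    ring
  have hT0 : ∀ (b : ℕ) (σ : Equiv.Perm (Fin (n + 1))),
      (∃ j, a j + j < shift n b (σ⁻¹ j)) → T b σ = 0 := by
    rintro b σ ⟨j, hj⟩
    refine mul_eq_zero_of_left (Finset.prod_eq_zero (Finset.mem_univ j) ?_) _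
    rw [xShift, if_neg (not_le.2 hj)]
  have hT1 : ∀ (b : ℕ) (σ : Equiv.Perm (Fin (n + 1))),
      (∀ j, shift n b (σ⁻¹ j) ≤ a j + j) → ∃ c : k, c ≠ 0 ∧ T b σ = monomial
        (famExp (Sum.elim (fun j => a j + j - shift n b (σ⁻¹ j)) fun _ : Unit => b)) c := by
    intro b σ h
    obtain ⟨c, hc, hcT⟩ := exists_prod_xHat_mul_yHat k (fun j => a j + j - shift n b (σ⁻¹ j)) b
    refine ⟨c, hc, hcT ▸ congrArg (· * yHat k b) (Finset.prod_congr rfl fun j _ => ?_)⟩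
    rw [xShift, if_pos (h j)]
  have hlow : ∀ b σ, n ≤ b → (b = n → σ ≠ π) → T b σ ∈ restrictSupport k {e | e ≺[wrevlex] d} := by
    intro b σ hb hσ
    by_cases h : ∃ j, a j + j < shift n b (σ⁻¹ j)
    · rw [hT0 b σ h]
      exact Submodule.zero_mem _
    push Not at h
    obtain ⟨c, -, hc⟩ := hT1 b σ h
    rw [hc, mem_restrictSupport_iff]
    intro e he
    rw [Finset.mem_singleton.1 (support_monomial_subset he)]
    rcases hb.eq_or_lt with rfl | hb
    · have hτ : ∀ j, shift n n (σ⁻¹ j) = (π * σ⁻¹) j := fun j => hπ _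
      simp only [hτ] at h ⊢
      refine famExp_perm_lt ha (π * σ⁻¹) (fun h1 => hσ rfl ?_) h n
      exact (mul_inv_eq_one.1 h1).symm
    · refine famExp_lt _ _ ?_ (Sum.inr ()) hb.ne' ?_
      · have h1 : ∑ j, (a j + j - shift n b (σ⁻¹ j)) + ∑ j, shift n b (σ⁻¹ j) =
            ∑ j, a j + ∑ j : Fin (n + 1), (j : ℕ) := by
          rw [← Finset.sum_add_distrib, ← Finset.sum_add_distrib]
          exact Finset.sum_congr rfl fun j _ => Nat.sub_add_cancel (h j)
        rw [Equiv.sum_comp σ⁻¹] at h1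
        have h2 := sum_shift n b
        simp only [Fintype.sum_sum_type, Sum.elim_inl, Sum.elim_inr, Finset.univ_unique,
          Finset.sum_singleton]
        omega
      · rintro (j | _) _
        · exact xVar_lt_yVar _ _
        · exact yVar_lt_yVar.2 hb
  have hdiag : ∀ j, shift n n (π⁻¹ j) = j := fun j => by
    rw [hπ, hinv]
  obtain ⟨c, hc, hcT⟩ := hT1 n π fun j => by rw [hdiag]; omega
  have hcT' : T n π = monomial d c := by
    rw [hcT]
    simp only [hdiag, Nat.add_sub_cancel]
    rfl
  refine ⟨((Equiv.Perm.sign π : ℤ) : k) * c, mul_ne_zero ?_ hc, ?_⟩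
  · rcases Int.units_eq_one_or (Equiv.Perm.sign π) with h | h <;> simp [h]
  rw [tamG_eq_sum k i hB, ← smul_eq_mul, ← smul_monomial, ← hcT',
    ← Finset.add_sum_erase _ _ (Finset.mem_range.2 hn), hdet,
    ← Finset.add_sum_erase _ _ (Finset.mem_univ π), add_assoc, add_sub_cancel_left]
  refine Submodule.add_mem _ (Submodule.sum_mem _ fun σ hσ => ?_)
    (Submodule.sum_mem _ fun b hb => ?_)
  · exact Submodule.smul_mem _ _ (hlow n σ le_rfl fun _ => Finset.ne_of_mem_erase hσ)
  · rcases (Finset.ne_of_mem_erase hb).lt_or_gt with hbn | hbn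
    · -- the last column repeats the column with the same shift
      have hb' : shift n b (⟨n - 1 - b, by omega⟩ : Fin n).castSucc = b := by
        rw [shift_castSucc]
        simp only
        omega
      rw [Matrix.det_zero_of_column_eq (i := (⟨n - 1 - b, by omega⟩ : Fin n).castSucc)
        (j := Fin.last n) (Fin.castSucc_lt_last _).ne fun j => by
          rw [Matrix.of_apply, Matrix.of_apply, hb', shift_last], mul_zero]
      exact Submodule.zero_mem _
    · change yHat k b * Matrix.det (Matrix.of fun j c => xShift k (a j + j) (shift n b c)) ∈ _
      rw [hdet]
      exact Submodule.sum_mem _ fun σ _ => Submodule.smul_mem _ _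
        (hlow b σ hbn.le fun h => absurd h hbn.ne')

end Determinant

/-! ### The initial ideal -/

section Main

open scoped MonomialOrder

theorem exists_eq_famExp (d : Var →₀ ℕ) :
    ∃ (ι κ : Type) (_ : Fintype ι) (_ : Fintype κ) (α : ι ⊕ κ → ℕ), d = famExp α := by
  induction d using Finsupp.induction_linear with
  | zero => exact ⟨Empty, Empty, inferInstance, inferInstance, fun _ => 0, by simp [famExp]⟩
  | add d e hd he =>
    obtain ⟨ι, κ, _, _, α, rfl⟩ := hd
    obtain ⟨ι', κ', _, _, α', rfl⟩ := he
    refine ⟨ι ⊕ ι', κ ⊕ κ', inferInstance, inferInstance,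
      Sum.elim (Sum.elim (fun i => α (.inl i)) fun i => α' (.inl i))
        (Sum.elim (fun j => α (.inr j)) fun j => α' (.inr j)), ?_⟩
    simp only [famExp, Fintype.sum_sum_type, Sum.elim_inl, Sum.elim_inr, famVar]
    abel
  | single v n =>
    obtain ⟨m, rfl | rfl⟩ := exists_eq_xVar_or_yVar v
    · exact ⟨Fin n, Empty, inferInstance, inferInstance, fun _ => m, by simp [famExp, famVar]⟩
    · exact ⟨Empty, Fin n, inferInstance, inferInstance, fun _ => m, by simp [famExp, famVar]⟩

variable (k : Type*) [Field k]

theorem prod_x_mul_y_eq_monomial {n : ℕ} (i : Fin (n + 1) → ℕ+) :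
    (∏ j, x k (i j)) * y k n.succPNat =
      monomial (famExp (Sum.elim (fun j => (i j).natPred) fun _ : Unit => n)) 1 := by
  rw [monomial_famExp]
  simp [Fintype.prod_sum_type, famVar, xVar, yVar, x, y]

theorem monIdeal_eq_span : monIdeal k = Ideal.span {p | ∃ (n : ℕ) (a : Fin (n + 1) → ℕ),
    p = monomial (famExp (Sum.elim a fun _ : Unit => n)) 1} := by
  rw [monIdeal]
  congr 1
  ext p
  constructor
  · rintro ⟨r, i, rfl⟩
    obtain ⟨n, rfl⟩ : ∃ n : ℕ, r = n.succPNat := ⟨r.natPred, (PNat.succPNat_natPred r).symm⟩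
    exact ⟨n, _, prod_x_mul_y_eq_monomial k i⟩
  · rintro ⟨n, a, rfl⟩
    refine ⟨n.succPNat, fun j => (a j).succPNat, ?_⟩
    refine Eq.trans ?_ (prod_x_mul_y_eq_monomial k fun j => (a j).succPNat).symm
    simp

theorem monomial_famExp_mem_monIdeal {ι κ : Type*} [Fintype ι] [Fintype κ] (α : ι ⊕ κ → ℕ)
    (j : κ) (hj : α (.inr j) < Fintype.card ι) (c : k) : monomial (famExp α) c ∈ monIdeal k := by
  classical
  set n := α (.inr j)
  obtain ⟨g⟩ : Nonempty (Fin (n + 1) ↪ ι) := Function.Embedding.nonempty_of_card_le (by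
    rw [Fintype.card_fin]
    omega)
  have hle : famExp (Sum.elim (fun t => α (.inl (g t))) fun _ : Unit => n) ≤ famExp α := by
    simp only [famExp, Fintype.sum_sum_type]
    refine add_le_add ?_ ?_
    · have := Finset.sum_map Finset.univ g fun i =>
        (Finsupp.single (famVar (.inl i : ι ⊕ κ) (α (.inl i))) 1 : Var →₀ ℕ)
      refine le_trans (le_of_eq this.symm) ?_
      exact Finset.sum_le_sum_of_subset (Finset.subset_univ _)
    · rw [Finset.univ_unique, Finset.sum_singleton]
      exact Finset.single_le_sum
        (f := fun j => (Finsupp.single (famVar (.inr j : ι ⊕ κ) (α (.inr j))) 1 : Var →₀ ℕ))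
        (fun _ _ => zero_le) (Finset.mem_univ j)
  obtain ⟨e, he⟩ := exists_add_of_le hle
  rw [monIdeal_eq_span, he, add_comm, ← mul_one c, ← monomial_mul]
  exact Ideal.mul_mem_left _ _ (Ideal.subset_span ⟨n, _, rfl⟩)

variable [CharZero k]

theorem initialIdeal_le_monIdeal :
    initialIdeal wrevlex (diffIdeal k (x k 1 * y k 1)) ≤ monIdeal k := by
  classical
  refine Ideal.span_le.2 ?_
  rintro _ ⟨h, hh, rfl⟩
  by_cases h0 : h = 0
  · simp [h0]
  obtain ⟨ι, κ, _, _, α, hα⟩ := exists_eq_famExp (wrevlex.degree h)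
  obtain ⟨j, hj⟩ : ∃ j, α (.inr j) < Fintype.card ι := by
    by_contra! H
    exact degree_ne_famExp k hh h0 α H hα
  rw [MonomialOrder.leadingTerm, hα]
  exact monomial_famExp_mem_monIdeal k α j hj _

theorem tamG_mem_diffIdeal {n : ℕ} (i : Fin (n + 1) → ℕ+) :
    tamG k i ∈ diffIdeal k (x k 1 * y k 1) := by
  rw [tamG, Matrix.det_apply']
  refine Ideal.sum_mem _ fun σ _ => Ideal.mul_mem_left _ _ ?_
  rw [Fin.prod_univ_castSucc]
  refine Ideal.mul_mem_left _ _ ?_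
  have h : (i (σ (Fin.last n)) : ℕ) + σ (Fin.last n) + 1 =
      (i (σ (Fin.last n))).natPred + σ (Fin.last n) + 2 := by
    have := PNat.natPred_add_one (i (σ (Fin.last n)))
    omega
  rw [Matrix.of_apply, if_neg (by simp), h, fNorm_eq]
  exact fHat_mem k _

theorem tamSet_subset_diffIdeal :
    tamSet k ⊆ (diffIdeal k (x k 1 * y k 1) : Set (MvPolynomial Var k)) := by
  rintro p (⟨n, -, rfl⟩ | ⟨r, hr, i, -, rfl⟩)
  · exact Ideal.subset_span ⟨n - 2, rfl⟩
  · obtain ⟨n, rfl⟩ : ∃ n, r = n + 1 := ⟨r - 1, by omega⟩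
    exact tamG_mem_diffIdeal k i

/-- For `n = 0` the element is a derivative of `x₁ y₁`: up to a factor, this is the determinant
with a single row. -/
theorem exists_mem_tamSet_isLead {n : ℕ} (i : Fin (n + 1) → ℕ+) (hi : Monotone i) :
    ∃ p ∈ tamSet k,
      IsLead wrevlex p (famExp (Sum.elim (fun j => (i j).natPred) fun _ : Unit => n)) := by
  rcases n with _ | n
  · refine ⟨f k (i 0 + 1), Or.inl ⟨_, by have := (i 0).pos; omega, rfl⟩, ?_⟩
    have h : ((i 0 + 1 - 2 : ℕ).factorial : k) ≠ 0 := by exact_mod_cast Nat.factorial_ne_zero _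
    have hf : f k (i 0 + 1) = ((i 0 + 1 - 2 : ℕ).factorial : k) • tamG k i := by
      have h1 : tamG k i = fNorm k (i 0 + 1) := by simp [tamG]
      rw [h1, fNorm, smul_smul, mul_inv_cancel₀ h, one_smul]
    rw [hf]
    exact (isLead_tamG k i hi).smul h
  · exact ⟨_, Or.inr ⟨n + 2, by omega, i, hi, rfl⟩, isLead_tamG k i hi⟩

theorem monIdeal_le_span_leadingTerm :
    monIdeal k ≤ Ideal.span (wrevlex.leadingTerm '' tamSet k) := by
  rw [monIdeal_eq_span, Ideal.span_le]
  rintro _ ⟨n, a, rfl⟩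
  -- the monomial does not depend on the order of its factors
  have hsort : famExp (Sum.elim a fun _ : Unit => n) =
      famExp (Sum.elim (a ∘ Tuple.sort a) fun _ : Unit => n) := by
    simp only [famExp, Fintype.sum_sum_type]
    congr 1
    exact (Equiv.sum_comp (Tuple.sort a) fun j =>
      (Finsupp.single (famVar (.inl j : Fin (n + 1) ⊕ Unit) (a j)) 1 : Var →₀ ℕ)).symm
  obtain ⟨p, hp, hlead⟩ := exists_mem_tamSet_isLead k
    (fun j => ((a ∘ Tuple.sort a) j).succPNat)
    fun j j' h => Nat.succPNat_le_succPNat.2 (Tuple.monotone_sort a h)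
  obtain ⟨c, hc, hpc⟩ := hlead.exists_leadingTerm
  simp only [Nat.natPred_succPNat] at hpc
  rw [hsort, ← inv_mul_cancel₀ hc, ← C_mul_monomial]
  exact Ideal.mul_mem_left _ _ (Ideal.subset_span ⟨p, hp, hpc⟩)

end Main

end NodeArc

theorem theorem3p5 (k : Type*) [Field k] [CharZero k] :
    NodeArc.IsGroebnerBasis NodeArc.wrevlex (NodeArc.tamSet k)
        (NodeArc.diffIdeal k (NodeArc.x k 1 * NodeArc.y k 1)) ∧
      NodeArc.initialIdeal NodeArc.wrevlex
          (NodeArc.diffIdeal k (NodeArc.x k 1 * NodeArc.y k 1)) =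
        NodeArc.monIdeal k := by
  have hsub := NodeArc.tamSet_subset_diffIdeal k
  have h1 : Ideal.span (NodeArc.wrevlex.leadingTerm '' NodeArc.tamSet k) ≤
      NodeArc.initialIdeal NodeArc.wrevlex
        (NodeArc.diffIdeal k (NodeArc.x k 1 * NodeArc.y k 1)) :=
    Ideal.span_mono (Set.image_mono hsub)
  have h2 := NodeArc.initialIdeal_le_monIdeal k
  have h3 := NodeArc.monIdeal_le_span_leadingTerm k
  exact ⟨⟨hsub, le_antisymm h1 (h2.trans h3)⟩, le_antisymm h2 (h3.trans h1)⟩
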